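/- Theorem 3.3. Let $p \ge 5$ be a prime. For complex $x$ with $|x|<1$ put $$f(x)=\prod_{n=1}^{\infty}\frac{(1-x^{pn})^p}{1-x^n},\qquad H(x)=\prod_{n=1}^{\infty}\frac{(1-x^{n})^p}{1-x^{pn}}.$$ Both products converge, and if $x=e^{2\pi i\tau}$ with $\operatorname{Im}\tau>0$, then $H(x)=\eta(\tau)^p/\eta(p\tau)$, where $\eta(\tau)=e^{2\pi i\tau/24}\prod_{n\ge1}(1-e^{2\pi i n\tau})$ is the Dedekind eta function. Let $h$ be an integer and $k$ a positive integer with $\gcd(h,k)=\gcd(p,k)=1$, let $B$ be any integer with $Bph\equiv-1\pmod k$, and let $t$ be a complex number with $\operatorname{Re}t>0$. Then $$f\!\left(e^{2\pi i h/k-t}\right)=\left(\frac{2\pi}{k}\right)^{(p-1)/2}\left(\frac{k}{p}\right)p^{-p/2}\,t^{-(p-1)/2}\exp\!\left\{\frac{p^2-1}{24}\,t-\frac{\pi i(p^2-1)h}{12k}\right\}H\!\left(\exp\!\left\{\frac{2\pi i B}{k}-\frac{4\pi^2}{k^2pt}\right\}\right),$$ where $\left(\frac{k}{p}\right)$ is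 the Legendre symbol. -/

import Mathlib

/-- The `n`-th factor (`n ≥ 1` in the product, here shifted to start from `n = 0`) of
`f(x) = ∏_{n ≥ 1} (1 - x^{pn})^p / (1 - x^n)`. -/
noncomputable def coreFactor (p : ℕ) (x : ℂ) (n : ℕ) : ℂ :=
  (1 - x ^ (p * (n + 1))) ^ p / (1 - x ^ (n + 1))

/-- `f(x) = ∏_{n ≥ 1} (1 - x^{pn})^p / (1 - x^n)`, meaningful for `|x| < 1`. -/
noncomputable def coreProduct (p : ℕ) (x : ℂ) : ℂ :=
  ∏' n : ℕ, coreFactor p x n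

/-- The `n`-th factor (shifted to start from `n = 0`) of
`H(x) = ∏_{n ≥ 1} (1 - x^n)^p / (1 - x^{pn})`. -/
noncomputable def dualFactor (p : ℕ) (x : ℂ) (n : ℕ) : ℂ :=
  (1 - x ^ (n + 1)) ^ p / (1 - x ^ (p * (n + 1)))

/-- `H(x) = ∏_{n ≥ 1} (1 - x^n)^p / (1 - x^{pn})`, meaningful for `|x| < 1`. -/
noncomputable def dualProduct (p : ℕ) (x : ℂ) : ℂ :=
  ∏' n : ℕ, dualFactor p x n

/-!
The proof rests on Klein forms, `kleinForm a b τ`, i.e. `θ₁(aτ + b, τ) / η(τ)³` with an exponential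
factor. They satisfy `kleinForm a b (γ τ) = (cτ + d)⁻¹ kleinForm a' b' τ` for every
`γ = (*, *; c, d) ∈ SL₂(ℤ)`, where `(a', b') = (a, b) γ`, with no root of unity
(`kleinForm_smul`): for the two generators of `SL₂(ℤ)` this follows from the functional equations
of the theta and eta functions, whose eighth roots of unity and square roots cancel. So no eta
multiplier or Dedekind sum is needed.

Let `p = 2r + 1`. By the Jacobi triple product and `∏ⱼ (1 - ζʲ X) = 1 - X^p`, the product of
`kleinForm 0 (j / p) τ` over `1 ≤ j ≤ r` is `i^r √p / H(q)` (`prod_kleinForm_zero_left`), and by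
sorting integers into residue classes mod `p`, the product of `kleinForm (j / p) 0 (pτ)` is
`(-1)^r q^{-(p² - 1) / 24} / f(q)` (`prod_kleinForm_right_zero`).

Put `τ = h / k + i t / 2π`, so that `e^{2πiτ}` is the argument of `f`. Since `B p h ≡ -1 mod k`,
there is `γ = (B, c; k, -p h) ∈ SL₂(ℤ)`, and `e^{2πi γ(pτ)}` is the argument of `H`. Now `γ` maps
the characteristic `(0, j / p)` to `(k j / p, -h j)`. The integer `-h j` contributes only a root of
unity, and multiplication of the half system `1, …, r` by `k` contributes the Legendre symbol by
Gauss's lemma (`prod_odd_periodic_mul`), up to another root of unity. The roots of unity cancel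
because `24 ∣ p² - 1` and `(h + 1)(k + 1)` is even (`prod_kleinForm_smul`).
-/

open Complex Filter Topology
open scoped Real MatrixGroups UpperHalfPlane

/-! ### The Jacobi triple product -/

/-- Euler's product `∏_{n ≥ 1} (1 - qⁿ)`. -/
noncomputable def eulerPhi (q : ℂ) : ℂ := ∏' n : ℕ, (1 - q ^ (n + 1))

/-- The finite `q`-Pochhammer product `(q; q)_n = ∏_{i=1}^{n} (1 - q^i)`. -/
noncomputable def qPochhammer (q : ℂ) (n : ℕ) : ℂ := ∏ i ∈ Finset.range n, (1 - q ^ (i + 1))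

/-- The reciprocal `1 / (q; q)_n`, extended by `0` to negative `n`; with this convention the
recurrence `qPochhammerInv_sub_one` holds at every integer. -/
noncomputable def qPochhammerInv (q : ℂ) (n : ℤ) : ℂ :=
  if 0 ≤ n then (qPochhammer q n.toNat)⁻¹ else 0

lemma one_sub_pow_succ_ne_zero {q : ℂ} (hq : ‖q‖ < 1) (n : ℕ) : 1 - q ^ (n + 1) ≠ 0 := by
  intro h
  have h1 : ‖q ^ (n + 1)‖ = 1 := by rw [← sub_eq_zero.mp h, norm_one]
  rw [norm_pow] at h1
  exact absurd h1 (pow_lt_one₀ (norm_nonneg _) hq (Nat.succ_ne_zero n)).ne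

lemma qPochhammer_ne_zero {q : ℂ} (hq : ‖q‖ < 1) (n : ℕ) : qPochhammer q n ≠ 0 :=
  Finset.prod_ne_zero_iff.mpr fun i _ => one_sub_pow_succ_ne_zero hq i

lemma qPochhammerInv_sub_one {q : ℂ} (hq : ‖q‖ < 1) (n : ℤ) :
    qPochhammerInv q (n - 1) = (1 - q ^ n) * qPochhammerInv q n := by
  rcases lt_trichotomy n 0 with h | rfl | h
  · simp [qPochhammerInv, show ¬ (0 ≤ n) by omega, show ¬ (1 ≤ n) by omega]
  · simp [qPochhammerInv]
  · obtain ⟨m, rfl⟩ : ∃ m : ℕ, n = (m + 1 : ℕ) := ⟨(n - 1).toNat, by omega⟩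
    have h1 : ((m + 1 : ℕ) : ℤ) - 1 = (m : ℕ) := by push_cast; ring
    have h2 := qPochhammer_ne_zero hq m
    have h3 := one_sub_pow_succ_ne_zero hq m
    have h4 : qPochhammer q (m + 1) = qPochhammer q m * (1 - q ^ (m + 1)) :=
      Finset.prod_range_succ _ _
    rw [h1, qPochhammerInv, qPochhammerInv, if_pos (by positivity), if_pos (by positivity),
      Int.toNat_natCast, Int.toNat_natCast, zpow_natCast, h4]
    field_simp

lemma tendsto_qPochhammer {q : ℂ} (hq : ‖q‖ < 1) :
    Tendsto (qPochhammer q) atTop (𝓝 (eulerPhi q)) :=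
  (ModularForm.multipliable_one_sub_pow hq).hasProd.tendsto_prod_nat

lemma eulerPhi_ne_zero {q : ℂ} (hq : ‖q‖ < 1) : eulerPhi q ≠ 0 := by
  have hs : Summable fun n : ℕ => ‖-q ^ (n + 1)‖ := by
    simpa using (summable_nat_add_iff 1).mpr (summable_geometric_of_lt_one (norm_nonneg _) hq)
  have := tprod_one_add_ne_zero_of_summable (R := ℂ) (f := fun n : ℕ => -q ^ (n + 1))
    (fun i => by simpa [← sub_eq_add_neg] using one_sub_pow_succ_ne_zero hq i) hs
  simpa [eulerPhi, ← sub_eq_add_neg] using this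

lemma tendsto_qPochhammerInv {q : ℂ} (hq : ‖q‖ < 1) :
    Tendsto (fun n : ℕ => qPochhammerInv q n) atTop (𝓝 (eulerPhi q)⁻¹) := by
  simpa [qPochhammerInv] using (tendsto_qPochhammer hq).inv₀ (eulerPhi_ne_zero hq)

lemma exists_norm_qPochhammer_le {q : ℂ} (hq : ‖q‖ < 1) : ∃ C, ∀ n, ‖qPochhammer q n‖ ≤ C := by
  obtain ⟨C, hC⟩ := (Metric.isBounded_range_of_tendsto _ (tendsto_qPochhammer hq)).exists_norm_le
  exact ⟨C, fun n => hC _ ⟨n, rfl⟩⟩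

lemma exists_norm_qPochhammerInv_le {q : ℂ} (hq : ‖q‖ < 1) :
    ∃ C, 0 ≤ C ∧ ∀ n, ‖qPochhammerInv q n‖ ≤ C := by
  obtain ⟨C, hC⟩ :=
    (Metric.isBounded_range_of_tendsto _ (tendsto_qPochhammerInv hq)).exists_norm_le
  have hC0 : 0 ≤ C := (norm_nonneg _).trans (hC _ ⟨0, rfl⟩)
  refine ⟨C, hC0, fun n => ?_⟩
  by_cases h : 0 ≤ n
  · lift n to ℕ using h
    exact hC _ ⟨n, rfl⟩
  · simpa [qPochhammerInv, h] using hC0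

/-- The coefficient of `x^k` in `∏_{i<N} (1 + x a^{2i+1}) (1 + x⁻¹ a^{2i+1})`: the Gaussian binomial
`[2N, N+k]` at `a²`, times `a^{k²}`. -/
noncomputable def tripleCoeff (a : ℂ) (N : ℕ) (k : ℤ) : ℂ :=
  qPochhammer (a ^ 2) (2 * N) * qPochhammerInv (a ^ 2) (N + k) * qPochhammerInv (a ^ 2) (N - k) *
    a ^ (k ^ 2)

lemma tripleCoeff_succ {a : ℂ} (ha : a ≠ 0) (ha1 : ‖a‖ < 1) (N : ℕ) (k : ℤ) :
    tripleCoeff a (N + 1) k = (1 + a ^ (4 * N + 2)) * tripleCoeff a N k +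
      a ^ (2 * N + 1) * (tripleCoeff a N (k - 1) + tripleCoeff a N (k + 1)) := by
  have hq : ‖a ^ 2‖ < 1 := by rw [norm_pow]; exact pow_lt_one₀ (norm_nonneg _) ha1 two_ne_zero
  have key := qPochhammerInv_sub_one hq
  set u := qPochhammerInv (a ^ 2) (N + 1 + k) with hu
  set v := qPochhammerInv (a ^ 2) (N + 1 - k) with hv
  have u1 : qPochhammerInv (a ^ 2) (N + k) = (1 - (a ^ 2) ^ (N + 1 + k : ℤ)) * u := by
    rw [← key]; congr 1; ring
  have v1 : qPochhammerInv (a ^ 2) (N - k) = (1 - (a ^ 2) ^ (N + 1 - k : ℤ)) * v := by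
    rw [← key]; congr 1; ring
  have u2 : qPochhammerInv (a ^ 2) (N + (k - 1)) =
      (1 - (a ^ 2) ^ (N + k : ℤ)) * ((1 - (a ^ 2) ^ (N + 1 + k : ℤ)) * u) := by
    rw [← u1, ← key]; congr 1; ring
  have v2 : qPochhammerInv (a ^ 2) (N - (k + 1)) =
      (1 - (a ^ 2) ^ (N - k : ℤ)) * ((1 - (a ^ 2) ^ (N + 1 - k : ℤ)) * v) := by
    rw [← v1, ← key]; congr 1; ring
  have u3 : qPochhammerInv (a ^ 2) (N + (k + 1)) = u := by rw [hu]; congr 1; ring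
  have v3 : qPochhammerInv (a ^ 2) (N - (k - 1)) = v := by rw [hv]; congr 1; ring
  have hE : qPochhammer (a ^ 2) (2 * (N + 1)) = qPochhammer (a ^ 2) (2 * N) *
      (1 - (a ^ 2) ^ (2 * N + 1)) * (1 - (a ^ 2) ^ (2 * N + 2)) := by
    rw [qPochhammer, show 2 * (N + 1) = 2 * N + 1 + 1 by ring, Finset.prod_range_succ,
      Finset.prod_range_succ, ← qPochhammer]
  have e1 : a ^ ((k - 1) ^ 2) = a ^ (k ^ 2) * (a ^ k)⁻¹ ^ 2 * a := by
    rw [show (k - 1) ^ 2 = k ^ 2 + (-k) * 2 + 1 by ring, zpow_add₀ ha, zpow_add₀ ha, zpow_mul,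
      zpow_neg, zpow_one]; norm_cast
  have e2 : a ^ ((k + 1) ^ 2) = a ^ (k ^ 2) * (a ^ k) ^ 2 * a := by
    rw [show (k + 1) ^ 2 = k ^ 2 + k * 2 + 1 by ring, zpow_add₀ ha, zpow_add₀ ha, zpow_mul,
      zpow_one]; norm_cast
  have ha2 : a ^ 2 ≠ 0 := pow_ne_zero 2 ha
  have hK : a ^ k ≠ 0 := zpow_ne_zero k ha
  have hsq (n : ℤ) : (a ^ 2) ^ n = (a ^ n) ^ 2 := by
    rw [← zpow_natCast, ← zpow_natCast, zpow_comm]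
  have f1 : (a ^ 2) ^ (N + 1 + k : ℤ) = (a ^ N) ^ 2 * a ^ 2 * (a ^ k) ^ 2 := by
    rw [hsq, zpow_add₀ ha, zpow_add₀ ha, zpow_one, zpow_natCast]; ring
  have f2 : (a ^ 2) ^ (N + 1 - k : ℤ) = (a ^ N) ^ 2 * a ^ 2 / (a ^ k) ^ 2 := by
    rw [hsq, zpow_sub₀ ha, zpow_add₀ ha, zpow_one, zpow_natCast]; ring
  have f3 : (a ^ 2) ^ (N + k : ℤ) = (a ^ N) ^ 2 * (a ^ k) ^ 2 := by
    rw [show (N + k : ℤ) = N + 1 + k - 1 by ring, zpow_sub₀ ha2, f1, zpow_one]; field_simp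
  have f4 : (a ^ 2) ^ (N - k : ℤ) = (a ^ N) ^ 2 / (a ^ k) ^ 2 := by
    rw [show (N - k : ℤ) = N + 1 - k - 1 by ring, zpow_sub₀ ha2, f2, zpow_one]; field_simp
  simp only [tripleCoeff]
  push_cast
  rw [← hu, ← hv, u1, v1, u2, v2, u3, v3, hE, e1, e2, f1, f2, f3, f4]
  have g1 : (a ^ 2) ^ (2 * N + 1) = (a ^ N) ^ 4 * a ^ 2 := by ring
  have g2 : (a ^ 2) ^ (2 * N + 2) = (a ^ N) ^ 4 * a ^ 4 := by ring
  have g3 : a ^ (4 * N + 2) = (a ^ N) ^ 4 * a ^ 2 := by ring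
  have g4 : a ^ (2 * N + 1) = (a ^ N) ^ 2 * a := by ring
  rw [g1, g2, g3, g4]
  generalize a ^ N = A
  generalize a ^ (k ^ 2) = S
  generalize a ^ k = K at hK
  generalize qPochhammer (a ^ 2) (2 * N) = E
  field_simp
  ring

lemma tripleCoeff_zero (a : ℂ) (k : ℤ) : tripleCoeff a 0 k = if k = 0 then 1 else 0 := by
  rcases lt_trichotomy k 0 with h | rfl | h
  · simp [tripleCoeff, qPochhammerInv, h.not_ge, h.ne]
  · simp [tripleCoeff, qPochhammerInv, qPochhammer]
  · simp [tripleCoeff, qPochhammerInv, h.not_ge, h.ne']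

/-- The finite form of the Jacobi triple product. -/
lemma hasSum_tripleCoeff {a x : ℂ} (ha : a ≠ 0) (ha1 : ‖a‖ < 1) (hx : x ≠ 0) (N : ℕ) :
    HasSum (fun k : ℤ => tripleCoeff a N k * x ^ k)
      (∏ i ∈ Finset.range N, ((1 + x * a ^ (2 * i + 1)) * (1 + x⁻¹ * a ^ (2 * i + 1)))) := by
  induction N with
  | zero =>
    have := hasSum_single (f := fun k : ℤ => tripleCoeff a 0 k * x ^ k) 0
      (fun k hk => by simp [tripleCoeff_zero, hk])
    simpa [tripleCoeff_zero] using this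
  | succ N ih =>
    rw [Finset.prod_range_succ]
    set P := ∏ i ∈ Finset.range N, ((1 + x * a ^ (2 * i + 1)) * (1 + x⁻¹ * a ^ (2 * i + 1)))
    have h1 : HasSum (fun k : ℤ => tripleCoeff a N (k - 1) * x ^ (k - 1)) P :=
      ((Equiv.subRight (1 : ℤ)).hasSum_iff (f := fun k => tripleCoeff a N k * x ^ k)).mpr ih
    have h2 : HasSum (fun k : ℤ => tripleCoeff a N (k + 1) * x ^ (k + 1)) P :=
      ((Equiv.addRight (1 : ℤ)).hasSum_iff (f := fun k => tripleCoeff a N k * x ^ k)).mpr ih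
    have := (ih.mul_left (1 + a ^ (4 * N + 2))).add
      ((h1.mul_left (a ^ (2 * N + 1) * x)).add (h2.mul_left (a ^ (2 * N + 1) * x⁻¹)))
    have hval : (1 + a ^ (4 * N + 2)) * P + (a ^ (2 * N + 1) * x * P +
        a ^ (2 * N + 1) * x⁻¹ * P) =
        P * ((1 + x * a ^ (2 * N + 1)) * (1 + x⁻¹ * a ^ (2 * N + 1))) := by
      rw [show a ^ (4 * N + 2) = (a ^ (2 * N + 1)) ^ 2 by ring]
      field_simp
      ring
    rw [hval] at this
    refine (congrArg (HasSum · _) (funext fun k => ?_)).mpr this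
    simp only [tripleCoeff_succ ha ha1, zpow_sub₀ hx, zpow_add₀ hx, zpow_one]
    field_simp

lemma tendsto_tripleCoeff {a : ℂ} (ha1 : ‖a‖ < 1) (k : ℤ) :
    Tendsto (fun N => tripleCoeff a N k) atTop
      (𝓝 ((eulerPhi (a ^ 2))⁻¹ * a ^ (k ^ 2))) := by
  have hq : ‖a ^ 2‖ < 1 := by rw [norm_pow]; exact pow_lt_one₀ (norm_nonneg _) ha1 two_ne_zero
  have hne := eulerPhi_ne_zero hq
  have h1 : Tendsto (fun N : ℕ => qPochhammer (a ^ 2) (2 * N)) atTop _ :=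
    (tendsto_qPochhammer hq).comp (tendsto_id.const_mul_atTop' two_pos)
  have hshift (l : ℤ) : Tendsto (fun N : ℕ => qPochhammerInv (a ^ 2) (N + l)) atTop
      (𝓝 (eulerPhi (a ^ 2))⁻¹) := by
    have ht : Tendsto (fun N : ℕ => ((N : ℤ) + l).toNat) atTop atTop :=
      tendsto_atTop.mpr fun b => by
        filter_upwards [eventually_ge_atTop (b + l.natAbs)] with N hN
        omega
    refine ((tendsto_qPochhammerInv hq).comp ht).congr' ?_
    filter_upwards [eventually_ge_atTop l.natAbs] with N hN
    simp only [Function.comp_apply]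
    congr 1
    omega
  have := ((h1.mul (hshift k)).mul (hshift (-k))).mul_const (a ^ (k ^ 2))
  rw [mul_inv_cancel₀ hne, one_mul] at this
  exact this

/-- **Jacobi triple product** for the two-variable theta function: the finite form, in the limit
under dominated convergence. -/
theorem tendsto_prod_jacobiTheta₂ (z : ℂ) {τ : ℂ} (hτ : 0 < τ.im) :
    Tendsto (fun N => ∏ i ∈ Finset.range N,
      ((1 + cexp (2 * π * I * z) * cexp (π * I * τ) ^ (2 * i + 1)) *
        (1 + (cexp (2 * π * I * z))⁻¹ * cexp (π * I * τ) ^ (2 * i + 1)))) atTop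
      (𝓝 ((eulerPhi (cexp (π * I * τ) ^ 2))⁻¹ * jacobiTheta₂ z τ)) := by
  set a := cexp (π * I * τ) with ha
  set x := cexp (2 * π * I * z) with hx
  have ha0 : a ≠ 0 := exp_ne_zero _
  have hx0 : x ≠ 0 := exp_ne_zero _
  have ha1 : ‖a‖ < 1 := by
    rw [ha, norm_exp]
    simp
    positivity
  have hq : ‖a ^ 2‖ < 1 := by rw [norm_pow]; exact pow_lt_one₀ (norm_nonneg _) ha1 two_ne_zero
  have hterm (k : ℤ) : jacobiTheta₂_term k z τ = a ^ (k ^ 2) * x ^ k := by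
    rw [jacobiTheta₂_term, ha, hx, ← exp_int_mul, ← exp_int_mul, ← exp_add]
    push_cast
    ring_nf
  obtain ⟨C, hC⟩ := exists_norm_qPochhammer_le hq
  obtain ⟨D, hD0, hD⟩ := exists_norm_qPochhammerInv_le hq
  have hsum := ((summable_jacobiTheta₂_term_iff z τ).mpr hτ).norm
  have := tendsto_tsum_of_dominated_convergence (𝓕 := atTop)
    (f := fun N k => tripleCoeff a N k * x ^ k)
    (g := fun k => (eulerPhi (a ^ 2))⁻¹ * a ^ (k ^ 2) * x ^ k)
    (bound := fun k => C * D * D * ‖jacobiTheta₂_term k z τ‖)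
    (hsum.mul_left _) (fun k => (tendsto_tripleCoeff ha1 k).mul_const _)
    (Eventually.of_forall fun N k => by
      have hC0 : 0 ≤ C := (norm_nonneg _).trans (hC 0)
      rw [hterm, tripleCoeff, mul_assoc _ (a ^ (k ^ 2)), norm_mul, norm_mul, norm_mul]
      gcongr
      · exact hC _
      · exact hD _
      · exact hD _)
  simp only [(hasSum_tripleCoeff ha0 ha1 hx0 _).tsum_eq, mul_assoc, tsum_mul_left] at this
  simpa only [jacobiTheta₂, hterm] using this

/-! ### The odd theta function -/

/-- The odd Jacobi theta function, normalised so that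
`θ₁(z, τ) = q^{1/8} (x^{1/2} - x^{-1/2}) ∏ (1 - qⁿ) (1 - x qⁿ) (1 - x⁻¹ qⁿ)`
with `x = e^{2πiz}` and `q = e^{2πiτ}`. -/
noncomputable def thetaOne (z τ : ℂ) : ℂ :=
  cexp (π * I * z + π * I * τ / 4) * jacobiTheta₂ (z + τ / 2 + 1 / 2) τ

lemma thetaOne_neg (z τ : ℂ) : thetaOne (-z) τ = -thetaOne z τ := by
  have h1 : jacobiTheta₂ (-z + τ / 2 + 1 / 2) τ = jacobiTheta₂ (z - τ / 2 - 1 / 2) τ := by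
    rw [← jacobiTheta₂_neg_left]; congr 1; ring
  have h2 : jacobiTheta₂ (z + τ / 2 + 1 / 2) τ =
      cexp (-π * I * (τ + 2 * (z - τ / 2 - 1 / 2))) * jacobiTheta₂ (z - τ / 2 - 1 / 2) τ := by
    rw [← jacobiTheta₂_add_left', ← jacobiTheta₂_add_left (z - τ / 2 - 1 / 2 + τ)]; congr 1; ring
  rw [thetaOne, thetaOne, h1, h2, ← mul_assoc, ← exp_add, ← neg_mul, ← exp_antiperiodic.sub_eq]
  congr 2
  ring

lemma thetaOne_add_one (z τ : ℂ) : thetaOne (z + 1) τ = -thetaOne z τ := by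
  rw [thetaOne, thetaOne, show z + 1 + τ / 2 + 1 / 2 = z + τ / 2 + 1 / 2 + 1 by ring,
    jacobiTheta₂_add_left, ← neg_mul, ← exp_antiperiodic]
  congr 2
  ring

lemma thetaOne_add_self (z τ : ℂ) :
    thetaOne (z + τ) τ = -cexp (-π * I * τ - 2 * π * I * z) * thetaOne z τ := by
  have h : z + τ + τ / 2 + 1 / 2 = z + τ / 2 + 1 / 2 + τ := by ring
  rw [thetaOne, thetaOne, h, jacobiTheta₂_add_left', ← exp_antiperiodic.sub_eq,
    ← mul_assoc, ← exp_add, ← mul_assoc, ← exp_add]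
  congr 2
  ring

lemma jacobiTheta₂_right_add_one (z τ : ℂ) :
    jacobiTheta₂ z (τ + 1) = jacobiTheta₂ (z + 1 / 2) τ := by
  refine tsum_congr fun n => ?_
  -- `n² ≡ n mod 2`
  obtain ⟨m, hm⟩ : Even (n ^ 2 - n) := by
    rw [Int.even_sub, Int.even_pow' two_ne_zero]
  have hm' : (n : ℂ) ^ 2 = n + (m + m) := by exact_mod_cast (sub_eq_iff_eq_add'.mp hm)
  rw [jacobiTheta₂_term, jacobiTheta₂_term,
    ← exp_periodic.int_mul m (2 * π * I * n * (z + 1 / 2) + π * I * n ^ 2 * τ)]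
  congr 1
  linear_combination π * I * hm'

lemma thetaOne_right_add_one (z τ : ℂ) :
    thetaOne z (τ + 1) = cexp (π * I / 4) * thetaOne z τ := by
  rw [thetaOne, thetaOne, jacobiTheta₂_right_add_one,
    show z + (τ + 1) / 2 + 1 / 2 + 1 / 2 = z + τ / 2 + 1 / 2 + 1 by ring,
    jacobiTheta₂_add_left, ← mul_assoc, ← exp_add]
  congr 2
  ring

/-- The factor `-i √(-iτ)` differs from that of `η³` (see `eta_inversion`) by exactly `1 / τ`. -/
lemma thetaOne_inversion (z : ℂ) {τ : ℂ} (hτ : τ ≠ 0) :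
    thetaOne (z / τ) (-1 / τ) =
      -I * (-I * τ) ^ (1 / 2 : ℂ) * cexp (π * I * z ^ 2 / τ) * thetaOne z τ := by
  have hs : (-I * τ) ^ (1 / 2 : ℂ) ≠ 0 := by simp [cpow_eq_zero_iff, hτ]
  have h1 : jacobiTheta₂ (z + τ / 2 + 1 / 2) τ = jacobiTheta₂ (z + τ / 2 - 1 / 2) τ := by
    rw [← jacobiTheta₂_add_left (z + τ / 2 - 1 / 2)]; congr 1; ring
  have h2 : z / τ + -1 / τ / 2 + 1 / 2 = (z + τ / 2 - 1 / 2) / τ := by field_simp; ring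
  have h3 : cexp (π * I * (z / τ) + π * I * (-1 / τ) / 4) = -I * cexp (π * I * z ^ 2 / τ) *
      cexp (π * I * z + π * I * τ / 4) * cexp (-π * I * (z + τ / 2 - 1 / 2) ^ 2 / τ) := by
    have h4 : -I = cexp (-(π / 2 * I)) := by rw [exp_neg, exp_pi_div_two_mul_I, inv_I]
    rw [h4, ← exp_add, ← exp_add, ← exp_add]
    congr 1
    field_simp
    ring
  rw [thetaOne, thetaOne, h1, jacobiTheta₂_functional_equation (z + τ / 2 - 1 / 2) τ, h2, h3]
  field_simp

/-! ### Klein forms -/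

lemma eta_add_one (τ : ℂ) : ModularForm.eta (τ + 1) = cexp (π * I / 12) * ModularForm.eta τ := by
  have h (n : ℕ) : ModularForm.eta_q n (τ + 1) = ModularForm.eta_q n τ := by
    rw [ModularForm.eta_q_eq_pow, ModularForm.eta_q_eq_pow, mul_add, mul_one, exp_periodic]
  simp only [ModularForm.eta, h, Function.Periodic.qParam]
  rw [← mul_assoc, ← exp_add]
  congr 2
  push_cast
  ring

/-- Mathlib's formula has `√τ / √i`; on the upper half-plane this is the principal value of
`√(-iτ)`. -/
lemma eta_inversion {τ : ℂ} (hτ : 0 < τ.im) :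
    ModularForm.eta (-1 / τ) = (-I * τ) ^ (1 / 2 : ℂ) * ModularForm.eta τ := by
  have h0 : τ ≠ 0 := by rintro rfl; simp at hτ
  have h := ModularForm.eta_comp_eq_csqrt_I_inv hτ
  have harg : 0 ≤ τ.arg := arg_nonneg_iff.mpr hτ.le
  have hlog : log (-I * τ) = log (-I) + log τ := by
    rw [log_mul_eq_add_log_iff (neg_ne_zero.mpr I_ne_zero) h0, arg_neg_I]
    constructor <;> linarith [arg_le_pi τ, Real.pi_pos]
  have hs : (-I * τ) ^ (1 / 2 : ℂ) = (sqrt I)⁻¹ * sqrt τ := by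
    rw [cpow_def_of_ne_zero (by simp [h0]), hlog, log_neg_I, sqrt_eq_exp I_ne_zero,
      sqrt_eq_exp h0, log_I, ← exp_neg, ← exp_add]
    congr 1
    ring
  rw [hs, mul_assoc]
  simpa using h

/-- The Klein form with characteristic `(a, b)`, up to a constant factor: the odd theta function at
`z = aτ + b` divided by `η³`, with the exponential factor that makes it equivariant under `SL₂(ℤ)`
without a multiplier. The characteristic may be complex. -/
noncomputable def kleinForm (a b τ : ℂ) : ℂ :=
  cexp (π * I * a * (a * τ + b)) * thetaOne (a * τ + b) τ / ModularForm.eta τ ^ 3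

lemma kleinForm_neg (a b τ : ℂ) : kleinForm (-a) (-b) τ = -kleinForm a b τ := by
  rw [kleinForm, kleinForm, show -a * τ + -b = -(a * τ + b) by ring, thetaOne_neg]
  ring_nf

lemma kleinForm_add_one_left (a b τ : ℂ) :
    kleinForm (a + 1) b τ = -cexp (-π * I * b) * kleinForm a b τ := by
  rw [kleinForm, kleinForm, show (a + 1) * τ + b = a * τ + b + τ by ring, thetaOne_add_self]
  have : cexp (π * I * (a + 1) * (a * τ + b + τ)) * cexp (-π * I * τ - 2 * π * I * (a * τ + b)) =
      cexp (-π * I * b) * cexp (π * I * a * (a * τ + b)) := by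
    rw [← exp_add, ← exp_add]; ring_nf
  linear_combination (-thetaOne (a * τ + b) τ / ModularForm.eta τ ^ 3) * this

lemma kleinForm_add_one_right (a b τ : ℂ) :
    kleinForm a (b + 1) τ = -cexp (π * I * a) * kleinForm a b τ := by
  rw [kleinForm, kleinForm, show a * τ + (b + 1) = a * τ + b + 1 by ring, thetaOne_add_one]
  have : cexp (π * I * a * (a * τ + b + 1)) =
      cexp (π * I * a) * cexp (π * I * a * (a * τ + b)) := by
    rw [← exp_add]; ring_nf
  rw [this]
  ring

lemma kleinForm_translation (a b τ : ℂ) : kleinForm a b (τ + 1) = kleinForm a (a + b) τ := by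
  have h : cexp (π * I / 12) ^ 3 = cexp (π * I / 4) := by rw [← exp_nat_mul]; push_cast; ring_nf
  rw [kleinForm, kleinForm, show a * (τ + 1) + b = a * τ + (a + b) by ring, thetaOne_right_add_one,
    eta_add_one, mul_pow, h]
  field_simp

lemma kleinForm_inversion (a b : ℂ) {τ : ℂ} (hτ : 0 < τ.im) :
    kleinForm a b (-1 / τ) = τ⁻¹ * kleinForm b (-a) τ := by
  have h0 : τ ≠ 0 := by rintro rfl; simp at hτ
  have hs : (-I * τ) ^ (1 / 2 : ℂ) ≠ 0 := by simp [cpow_eq_zero_iff, h0]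
  have hs2 : ((-I * τ) ^ (1 / 2 : ℂ)) ^ 2 = -I * τ := by
    rw [← cpow_nat_mul]; norm_num
  have hz : a * (-1 / τ) + b = (b * τ + -a) / τ := by field_simp; ring
  rw [kleinForm, kleinForm, hz, thetaOne_inversion _ h0, eta_inversion hτ]
  have he : cexp (π * I * a * ((b * τ + -a) / τ)) * cexp (π * I * (b * τ + -a) ^ 2 / τ) =
      cexp (π * I * b * (b * τ + -a)) := by
    rw [← exp_add]
    congr 1
    field_simp
    ring
  rw [← he, mul_pow, pow_succ _ 2, hs2]
  field_simp

lemma intDenom_ne_zero (γ : SL(2, ℤ)) (τ : ℍ) : (γ 1 0 : ℂ) * τ + γ 1 1 ≠ 0 := by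
  simpa [ModularGroup.denom_apply] using UpperHalfPlane.denom_ne_zero γ τ

lemma coe_smul_eq_div (γ : SL(2, ℤ)) (τ : ℍ) :
    (↑(γ • τ) : ℂ) = (γ 0 0 * τ + γ 0 1) / (γ 1 0 * τ + γ 1 1) := by
  rw [UpperHalfPlane.coe_specialLinearGroup_apply]
  simp

/-- Klein forms are equivariant under `SL₂(ℤ)`, acting on characteristics from the right. -/
theorem kleinForm_smul (γ : SL(2, ℤ)) (a b : ℂ) (τ : ℍ) :
    kleinForm a b ↑(γ • τ) = ((γ 1 0 : ℂ) * τ + γ 1 1)⁻¹ *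
      kleinForm (a * γ 0 0 + b * γ 1 0) (a * γ 0 1 + b * γ 1 1) τ := by
  have hγ : γ ∈ Subgroup.closure {ModularGroup.S, ModularGroup.T} := by
    simp [SpecialLinearGroup.SL2Z_generators]
  induction hγ using Subgroup.closure_induction generalizing a b τ with
  | one => simp
  | mem g hg =>
    rcases hg with rfl | rfl
    · have := kleinForm_inversion a b τ.im_pos
      rw [UpperHalfPlane.modular_S_smul]
      simpa [ModularGroup.S, neg_div] using this
    · rw [UpperHalfPlane.modular_T_smul]
      have := kleinForm_translation a b τ
      simpa [ModularGroup.T, add_comm] using this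
  | mul g h _ _ ig ih =>
    have hj := intDenom_ne_zero h τ
    have hj' := intDenom_ne_zero g (h • τ)
    rw [coe_smul_eq_div] at hj'
    have hj2 : ((g 1 0 : ℂ) * ((h 0 0 * τ + h 0 1) / (h 1 0 * τ + h 1 1)) + g 1 1) *
        (h 1 0 * τ + h 1 1) = (g 1 0 * h 0 0 + g 1 1 * h 1 0) * τ +
          (g 1 0 * h 0 1 + g 1 1 * h 1 1) := by
      rw [add_mul, mul_assoc, div_mul_cancel₀ _ hj]
      ring
    rw [mul_smul, ig, ih, coe_smul_eq_div]
    simp only [Matrix.SpecialLinearGroup.coe_mul, Matrix.mul_apply, Fin.sum_univ_two, Int.cast_add,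
      Int.cast_mul]
    rw [← hj2, mul_inv, mul_assoc]
    congr 3 <;> ring
  | inv g _ ig =>
    have hdet : (g 0 0 : ℂ) * g 1 1 - g 0 1 * g 1 0 = 1 := by
      exact_mod_cast (Matrix.det_fin_two g.1).symm.trans g.2
    obtain ⟨σ, rfl⟩ : ∃ σ : ℍ, τ = g • σ := ⟨g⁻¹ • τ, by simp⟩
    have hj := intDenom_ne_zero g σ
    rw [inv_smul_smul, ig, coe_smul_eq_div]
    simp only [Matrix.SpecialLinearGroup.SL2_inv_expl, Matrix.cons_val_zero,
      Matrix.cons_val_one, Int.cast_neg]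
    have hj2 : -(g 1 0 : ℂ) * ((g 0 0 * (σ : ℂ) + g 0 1) / (g 1 0 * (σ : ℂ) + g 1 1)) +
        g 0 0 = (g 1 0 * (σ : ℂ) + g 1 1)⁻¹ := by
      apply eq_inv_of_mul_eq_one_left
      rw [add_mul, mul_assoc, div_mul_cancel₀ _ hj]
      linear_combination hdet
    rw [hj2, inv_inv, mul_inv_cancel_left₀ hj]
    congr 1
    · linear_combination -a * hdet
    · linear_combination -b * hdet

/-! ### Gauss's lemma -/

/-- **Gauss's lemma**, multiplicative form: if `F` is odd and has period `p`, replacing `F j` by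
`F (k j)` in the product over a half system `1, …, (p - 1) / 2` multiplies it by `(k / p)`. -/
theorem prod_odd_periodic_mul (p : ℕ) [Fact p.Prime] (hp : p ≠ 2) {k : ℤ} (hk : (k : ZMod p) ≠ 0)
    {F : ℤ → ℂ} (hodd : ∀ n, F (-n) = -F n) (hper : Function.Periodic F p) :
    ∏ j ∈ Finset.Ico 1 (p / 2).succ, F (k * j) =
      (legendreSym p k : ℂ) * ∏ j ∈ Finset.Ico 1 (p / 2).succ, F j := by
  have hF (m n : ℤ) (h : (m : ZMod p) = n) : F m = F n := by
    obtain ⟨c, hc⟩ := (ZMod.intCast_eq_intCast_iff_dvd_sub m n p).mp h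
    rw [show n = m + c * p by linear_combination hc]
    simpa using (hper.int_mul c m).symm
  have hsign (j : ℕ) : F (k * j) = (if p / 2 < ((k : ZMod p) * j).val then -1 else 1) *
      F (((k : ZMod p) * j).valMinAbs.natAbs : ℕ) := by
    rw [hF (k * j) ((k : ZMod p) * j).valMinAbs (by simp)]
    split_ifs with h
    · have h1 : ((k : ZMod p) * j).valMinAbs < 0 := by
        rw [← not_le, ZMod.valMinAbs_nonneg_iff]; omega
      rw [Int.ofNat_natAbs_of_nonpos h1.le, hodd]; ring
    · have h1 : 0 ≤ ((k : ZMod p) * j).valMinAbs := by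
        rw [ZMod.valMinAbs_nonneg_iff]; omega
      rw [Int.natAbs_of_nonneg h1, one_mul]
  have hmap := congrArg (fun s : Multiset ℕ => (s.map fun n : ℕ => F n).prod)
    (ZMod.Ico_map_valMinAbs_natAbs_eq_Ico_map_id p (k : ZMod p) hk)
  rw [Multiset.map_map, Multiset.map_map] at hmap
  rw [Finset.prod_congr rfl fun j _ => hsign j, Finset.prod_mul_distrib, ZMod.gauss_lemma hp hk,
    Finset.prod_ite]
  simp only [Finset.prod_const, one_pow, mul_one,
    Int.cast_pow, Int.cast_neg, Int.cast_one]
  exact congrArg _ hmap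

/-! ### Product expansions -/

lemma multipliable_one_sub_mul_pow {q : ℂ} (hq : ‖q‖ < 1) (c : ℂ) :
    Multipliable fun n : ℕ => 1 - c * q ^ n := by
  have h := ((summable_geometric_of_norm_lt_one hq).mul_left c).neg
  simpa [sub_eq_add_neg] using Complex.multipliable_one_add_of_summable h

lemma multipliable_one_sub_mul_pow_succ {q : ℂ} (hq : ‖q‖ < 1) (c : ℂ) :
    Multipliable fun n : ℕ => 1 - c * q ^ (n + 1) := by
  simpa only [pow_succ', mul_assoc] using multipliable_one_sub_mul_pow hq (c * q)

lemma norm_exp_two_pi_mul_I_lt_one {τ : ℂ} (hτ : 0 < τ.im) : ‖cexp (2 * π * I * τ)‖ < 1 :=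
  UpperHalfPlane.norm_exp_two_pi_I_lt_one ⟨τ, hτ⟩

lemma eta_eq (τ : ℂ) :
    ModularForm.eta τ = cexp (2 * π * I * τ / 24) * eulerPhi (cexp (2 * π * I * τ)) := by
  simp [ModularForm.eta, ModularForm.eta_q_eq_pow, eulerPhi, Function.Periodic.qParam]

/-- Product expansion of the odd theta function, from the Jacobi triple product. -/
theorem thetaOne_eq_tprod (z : ℂ) {τ : ℂ} (hτ : 0 < τ.im) :
    thetaOne z τ = cexp (π * I * τ / 4) * (cexp (π * I * z) - cexp (-(π * I * z))) *
      (eulerPhi (cexp (2 * π * I * τ)) *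
        ∏' n : ℕ, ((1 - cexp (2 * π * I * z) * cexp (2 * π * I * τ) ^ (n + 1)) *
          (1 - cexp (-(2 * π * I * z)) * cexp (2 * π * I * τ) ^ (n + 1)))) := by
  set q := cexp (2 * π * I * τ) with hq
  set x := cexp (2 * π * I * z) with hx
  have hq1 : ‖q‖ < 1 := norm_exp_two_pi_mul_I_lt_one hτ
  have hlim := tendsto_prod_jacobiTheta₂ (z + τ / 2 + 1 / 2) hτ
  have ha2 : cexp (π * I * τ) ^ 2 = q := by rw [← exp_nat_mul, hq]; push_cast; ring_nf
  have hx' : cexp (2 * π * I * (z + τ / 2 + 1 / 2)) = -(x * cexp (π * I * τ)) := by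
    rw [hx, ← exp_add, ← exp_antiperiodic]; ring_nf
  have ha : cexp (π * I * τ) ≠ 0 := exp_ne_zero _
  have hx0 : x ≠ 0 := exp_ne_zero _
  have hxi : cexp (-(2 * π * I * z)) = x⁻¹ := exp_neg _
  have hq0 : q ≠ 0 := exp_ne_zero _
  have hphi := eulerPhi_ne_zero hq1
  rw [ha2, hx'] at hlim
  -- after the shift by half a period the partial products are off by one factor in `x⁻¹`
  have hfac (N : ℕ) : (1 - x⁻¹ * q ^ N) * (∏ i ∈ Finset.range N,
      ((1 + -(x * cexp (π * I * τ)) * cexp (π * I * τ) ^ (2 * i + 1)) *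
        (1 + (-(x * cexp (π * I * τ)))⁻¹ * cexp (π * I * τ) ^ (2 * i + 1)))) =
      (1 - x⁻¹) * ∏ i ∈ Finset.range N, ((1 - x * q ^ (i + 1)) * (1 - x⁻¹ * q ^ (i + 1))) := by
    induction N with
    | zero => simp
    | succ N ih =>
      have e1 : cexp (π * I * τ) ^ (2 * N + 1) = q ^ N * cexp (π * I * τ) := by
        rw [pow_succ, pow_mul, ha2]
      have e2 : cexp (π * I * τ) * cexp (π * I * τ) = q := by rw [← sq, ha2]
      have e3 : 1 + -(x * cexp (π * I * τ)) * cexp (π * I * τ) ^ (2 * N + 1) =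
          1 - x * q ^ (N + 1) := by
        rw [e1, pow_succ]; linear_combination (-x * q ^ N) * e2
      have e4 : 1 + (-(x * cexp (π * I * τ)))⁻¹ * cexp (π * I * τ) ^ (2 * N + 1) =
          1 - x⁻¹ * q ^ N := by
        rw [e1]; field_simp; ring
      rw [Finset.prod_range_succ, Finset.prod_range_succ, e3, e4]
      linear_combination ((1 - x⁻¹ * q ^ (N + 1)) * (1 - x * q ^ (N + 1))) * ih
  have hmul := ((multipliable_one_sub_mul_pow_succ hq1 x).mul
    (multipliable_one_sub_mul_pow_succ hq1 x⁻¹)).hasProd.tendsto_prod_nat.const_mul (1 - x⁻¹)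
  have hone : Tendsto (fun N : ℕ => 1 - x⁻¹ * q ^ N) atTop (𝓝 1) := by
    simpa using ((tendsto_pow_atTop_nhds_zero_of_norm_lt_one hq1).const_mul x⁻¹).const_sub 1
  have hlim' := hone.mul hlim
  simp only [hfac] at hlim'
  have := tendsto_nhds_unique hlim' hmul
  rw [one_mul, inv_mul_eq_iff_eq_mul₀ hphi] at this
  rw [thetaOne, this, hxi]
  have hxx : cexp (π * I * z) * (1 - x⁻¹) = cexp (π * I * z) - cexp (-(π * I * z)) := by
    rw [mul_sub, mul_one, ← hxi, ← exp_add]; ring_nf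
  rw [exp_add, ← hxx]
  ring

/-- The factors `q^{1/8}` of `θ₁` and of `η³` cancel. -/
theorem kleinForm_eq_tprod (a b : ℂ) {τ : ℂ} (hτ : 0 < τ.im) :
    kleinForm a b τ = cexp (π * I * a * (a * τ + b)) *
      (cexp (π * I * (a * τ + b)) - cexp (-(π * I * (a * τ + b)))) *
      (∏' n : ℕ, ((1 - cexp (2 * π * I * (a * τ + b)) * cexp (2 * π * I * τ) ^ (n + 1)) *
          (1 - cexp (-(2 * π * I * (a * τ + b))) * cexp (2 * π * I * τ) ^ (n + 1)))) /
      eulerPhi (cexp (2 * π * I * τ)) ^ 2 := by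
  have hphi := eulerPhi_ne_zero (norm_exp_two_pi_mul_I_lt_one hτ)
  have he : cexp (2 * π * I * τ / 24) ^ 3 = cexp (π * I * τ / 4) := by
    rw [← exp_nat_mul]; push_cast; ring_nf
  have he0 : cexp (π * I * τ / 4) ≠ 0 := exp_ne_zero _
  rw [kleinForm, thetaOne_eq_tprod _ hτ, eta_eq, mul_pow, he]
  generalize ∏' n : ℕ, ((1 - cexp (2 * π * I * (a * τ + b)) * cexp (2 * π * I * τ) ^ (n + 1)) *
          (1 - cexp (-(2 * π * I * (a * τ + b))) * cexp (2 * π * I * τ) ^ (n + 1))) = P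
  generalize eulerPhi (cexp (2 * π * I * τ)) = Q at hphi
  field_simp

/-! ### Products of Klein forms at torsion points -/

/-- Pairing `i` with `2r + 1 - i` in a product over `1, …, 2r`. -/
lemma prod_range_two_mul_eq {M : Type*} [CommMonoid M] (f : ℕ → M) (r : ℕ) :
    ∏ i ∈ Finset.range (2 * r), f (i + 1) =
      ∏ i ∈ Finset.range r, (f (i + 1) * f (2 * r + 1 - (i + 1))) := by
  rw [two_mul, Finset.prod_range_add, Finset.prod_mul_distrib,
    ← Finset.prod_range_reflect (fun x => f (r + x + 1))]
  congr 1
  refine Finset.prod_congr rfl fun i hi => ?_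
  have := Finset.mem_range.mp hi
  congr 1
  omega

lemma prod_range_one_sub_zeta_mul {r : ℕ} {ζ : ℂ} (hζ : IsPrimitiveRoot ζ (2 * r + 1)) (X : ℂ) :
    (1 - X) * ∏ i ∈ Finset.range r, ((1 - ζ ^ (i + 1) * X) * (1 - (ζ ^ (i + 1))⁻¹ * X)) =
      1 - X ^ (2 * r + 1) := by
  have h := congrArg (Polynomial.eval 1)
    (X_pow_sub_C_eq_prod hζ (Nat.succ_pos _) (α := X) (a := X ^ (2 * r + 1)) rfl)
  simp only [Polynomial.eval_sub, Polynomial.eval_pow, Polynomial.eval_X, one_pow,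
    Polynomial.eval_C, Polynomial.eval_prod] at h
  rw [h, Finset.prod_range_succ', prod_range_two_mul_eq (fun i => 1 - ζ ^ i * X), pow_zero, one_mul,
    mul_comm]
  congr 1
  refine Finset.prod_congr rfl fun i hi => ?_
  have hi := Finset.mem_range.mp hi
  have : ζ ^ (2 * r + 1 - (i + 1)) = (ζ ^ (i + 1))⁻¹ := by
    rw [pow_sub₀ ζ (hζ.ne_zero (by omega)) (by omega), hζ.pow_eq_one, one_mul]
  rw [this]

lemma prod_range_one_sub_zeta {r : ℕ} {ζ : ℂ} (hζ : IsPrimitiveRoot ζ (2 * r + 1)) :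
    ∏ i ∈ Finset.range r, ((1 - ζ ^ (i + 1)) * (1 - (ζ ^ (i + 1))⁻¹)) = (2 * r + 1 : ℕ) := by
  have h := IsPrimitiveRoot.prod_one_sub_pow_eq_order hζ
  rw [prod_range_two_mul_eq (fun i => 1 - ζ ^ i)] at h
  rw [Nat.cast_succ, ← h]
  refine Finset.prod_congr rfl fun i hi => ?_
  have hi := Finset.mem_range.mp hi
  have : ζ ^ (2 * r + 1 - (i + 1)) = (ζ ^ (i + 1))⁻¹ := by
    rw [pow_sub₀ ζ (hζ.ne_zero (by omega)) (by omega), hζ.pow_eq_one, one_mul]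
  rw [this]

lemma norm_pow_lt_one {q : ℂ} (hq : ‖q‖ < 1) {n : ℕ} (hn : n ≠ 0) : ‖q ^ n‖ < 1 := by
  rw [norm_pow]
  exact pow_lt_one₀ (norm_nonneg _) hq hn

lemma sum_range_succ_cast (r : ℕ) :
    ∑ i ∈ Finset.range r, ((i + 1 : ℕ) : ℂ) = ((2 * r + 1 : ℂ) ^ 2 - 1) / 8 := by
  induction r with
  | zero => simp
  | succ n ih => rw [Finset.sum_range_succ, ih]; push_cast; ring

lemma sum_range_succ_sq_cast (r : ℕ) :
    ∑ i ∈ Finset.range r, ((i + 1 : ℕ) : ℂ) ^ 2 =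
      (2 * r + 1) * ((2 * r + 1 : ℂ) ^ 2 - 1) / 24 := by
  induction r with
  | zero => simp
  | succ n ih => rw [Finset.sum_range_succ, ih]; push_cast; ring

lemma prod_tprod_root_of_unity {r : ℕ} {ζ q : ℂ} (hζ : IsPrimitiveRoot ζ (2 * r + 1))
    (hq : ‖q‖ < 1) :
    ∏ i ∈ Finset.range r, ∏' n : ℕ,
      ((1 - ζ ^ (i + 1) * q ^ (n + 1)) * (1 - (ζ ^ (i + 1))⁻¹ * q ^ (n + 1))) =
      eulerPhi (q ^ (2 * r + 1)) / eulerPhi q := by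
  have hm (i : ℕ) : Multipliable fun n : ℕ =>
      ((1 - ζ ^ (i + 1) * q ^ (n + 1)) * (1 - (ζ ^ (i + 1))⁻¹ * q ^ (n + 1))) :=
    (multipliable_one_sub_mul_pow_succ hq _).mul (multipliable_one_sub_mul_pow_succ hq _)
  rw [eq_div_iff (eulerPhi_ne_zero hq), ← Multipliable.tprod_finsetProd fun i _ => hm i, mul_comm,
    eulerPhi, eulerPhi, ← (ModularForm.multipliable_one_sub_pow hq).tprod_mul
      (multipliable_prod fun i _ => hm i)]
  refine tprod_congr fun n => ?_
  rw [prod_range_one_sub_zeta_mul hζ, ← pow_mul, ← pow_mul, mul_comm]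

lemma prod_two_mul_sin (r : ℕ) :
    ∏ i ∈ Finset.range r, 2 * Real.sin (π * ((i + 1 : ℕ) / (2 * r + 1 : ℕ))) =
      √(2 * r + 1 : ℕ) := by
  have hp : (0 : ℝ) < (2 * r + 1 : ℕ) := by positivity
  rw [eq_comm, Real.sqrt_eq_iff_eq_sq hp.le]
  · have hζ := Complex.isPrimitiveRoot_exp (2 * r + 1) (Nat.succ_ne_zero _)
    have h := prod_range_one_sub_zeta hζ
    rw [← ofReal_inj, ← Finset.prod_pow]
    push_cast at h ⊢
    refine h.symm.trans (Finset.prod_congr rfl fun i _ => ?_)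
    rw [← exp_nat_mul, ← exp_neg]
    have h1 : ((i + 1 : ℕ) : ℂ) * (2 * π * I / (2 * r + 1)) =
        2 * ((π * ((i + 1) / (2 * r + 1)) : ℂ) * I) := by push_cast; ring
    rw [h1]
    generalize (π * ((i + 1) / (2 * r + 1)) : ℂ) = θ
    have e1 : cexp (2 * (θ * I)) = cexp (θ * I) ^ 2 := by rw [← exp_nat_mul]; norm_num
    have e2 : cexp (-(2 * (θ * I))) = cexp (-θ * I) ^ 2 := by
      rw [← exp_nat_mul]; push_cast; ring_nf
    have e3 : cexp (θ * I) * cexp (-θ * I) = 1 := by rw [← exp_add]; simp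
    rw [sin, e1, e2]
    linear_combination (cexp (θ * I) * cexp (-θ * I) - 1) * e3 -
      (cexp (-θ * I) - cexp (θ * I)) ^ 2 * I_sq
  · refine Finset.prod_nonneg fun i hi => ?_
    have hi := Finset.mem_range.mp hi
    have h1 : ((i + 1 : ℕ) : ℝ) / (2 * r + 1 : ℕ) ≤ 1 := by
      rw [div_le_one hp]; exact_mod_cast (by omega)
    have h0 : 0 ≤ ((i + 1 : ℕ) : ℝ) / (2 * r + 1 : ℕ) := by positivity
    have := Real.sin_nonneg_of_nonneg_of_le_pi (mul_nonneg Real.pi_pos.le h0)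
      (mul_le_of_le_one_right Real.pi_pos.le h1)
    positivity

/-- The product of the Klein forms at the torsion points `j / p` is `1 / H(q)`, up to a constant. -/
theorem prod_kleinForm_zero_left (r : ℕ) {τ : ℂ} (hτ : 0 < τ.im) :
    ∏ i ∈ Finset.range r, kleinForm 0 ((i + 1 : ℕ) / (2 * r + 1 : ℕ)) τ =
      I ^ r * (√(2 * r + 1 : ℕ) : ℝ) * (eulerPhi (cexp (2 * π * I * τ) ^ (2 * r + 1)) /
        eulerPhi (cexp (2 * π * I * τ)) ^ (2 * r + 1)) := by
  have hq1 := norm_exp_two_pi_mul_I_lt_one hτ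
  have hζ := Complex.isPrimitiveRoot_exp (2 * r + 1) (Nat.succ_ne_zero _)
  have key := prod_tprod_root_of_unity hζ hq1
  have hphi := eulerPhi_ne_zero hq1
  have hterm (i : ℕ) : kleinForm 0 ((i + 1 : ℕ) / (2 * r + 1 : ℕ)) τ =
      I * ((2 * Real.sin (π * ((i + 1 : ℕ) / (2 * r + 1 : ℕ))) : ℝ) : ℂ) *
      (∏' n : ℕ, ((1 - cexp (2 * π * I / (2 * r + 1 : ℕ)) ^ (i + 1) *
          cexp (2 * π * I * τ) ^ (n + 1)) *
        (1 - (cexp (2 * π * I / (2 * r + 1 : ℕ)) ^ (i + 1))⁻¹ * cexp (2 * π * I * τ) ^ (n + 1)))) *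
      (eulerPhi (cexp (2 * π * I * τ)) ^ 2)⁻¹ := by
    have h1 : cexp (2 * π * I / (2 * r + 1 : ℕ)) ^ (i + 1) =
        cexp (2 * π * I * ((i + 1 : ℕ) / (2 * r + 1 : ℕ))) := by
      rw [← exp_nat_mul]; ring_nf
    rw [kleinForm_eq_tprod _ _ hτ, h1, ← exp_neg]
    simp only [mul_zero, zero_mul, zero_add, exp_zero, one_mul]
    rw [div_eq_mul_inv]
    congr 2
    push_cast
    rw [sin]
    ring_nf
    simp only [I_sq]
    ring_nf
  simp only [hterm, Finset.prod_mul_distrib, key, Finset.prod_const, Finset.card_range]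
  rw [← ofReal_prod, prod_two_mul_sin]
  generalize eulerPhi (cexp (2 * π * I * τ)) = P at hphi
  rw [inv_pow, ← pow_mul, pow_succ P (2 * r)]
  field_simp

/-- Sorting the factors of `∏ (1 - qᵐ)` by the residue `±j` or `0` of `m` mod `2r + 1`. -/
lemma prod_tprod_residues (r : ℕ) {q : ℂ} (hq : ‖q‖ < 1) :
    (∏ i ∈ Finset.range r, ∏' n : ℕ, ((1 - q ^ ((2 * r + 1) * n + (i + 1))) *
      (1 - q ^ ((2 * r + 1) * n + (2 * r + 1 - (i + 1)))))) * eulerPhi (q ^ (2 * r + 1)) =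
      eulerPhi q := by
  have hQ : ‖q ^ (2 * r + 1)‖ < 1 := norm_pow_lt_one hq (Nat.succ_ne_zero (2 * r))
  have hm (l : ℕ) : Multipliable fun n : ℕ => 1 - q ^ ((2 * r + 1) * n + l) := by
    refine (multipliable_one_sub_mul_pow hQ (q ^ l)).congr fun n => ?_
    rw [pow_add q _ l, pow_mul q (2 * r + 1) n, mul_comm]
  have hfin (N : ℕ) : (∏ i ∈ Finset.range r, ∏ n ∈ Finset.range N,
      ((1 - q ^ ((2 * r + 1) * n + (i + 1))) *
      (1 - q ^ ((2 * r + 1) * n + (2 * r + 1 - (i + 1)))))) *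
      ∏ n ∈ Finset.range N, (1 - (q ^ (2 * r + 1)) ^ (n + 1)) =
      ∏ m ∈ Finset.range ((2 * r + 1) * N), (1 - q ^ (m + 1)) := by
    induction N with
    | zero => simp
    | succ N ih =>
      have h := prod_range_two_mul_eq (fun i => 1 - q ^ ((2 * r + 1) * N + i)) r
      simp only [Finset.prod_range_succ, Finset.prod_mul_distrib] at ih ⊢
      rw [mul_add_one, Finset.prod_range_add, ← ih, Finset.prod_range_succ _ (2 * r)]
      simp only [add_assoc] at h ⊢
      rw [h, Finset.prod_mul_distrib, ← pow_mul, mul_add_one]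
      ring
  have h1 := (tendsto_finsetProd (Finset.range r) fun i _ =>
    ((hm (i + 1)).mul (hm (2 * r + 1 - (i + 1)))).hasProd.tendsto_prod_nat).mul
      (ModularForm.multipliable_one_sub_pow hQ).hasProd.tendsto_prod_nat
  have h2 := (ModularForm.multipliable_one_sub_pow hq).hasProd.tendsto_prod_nat.comp
    (tendsto_id.const_mul_atTop' (Nat.succ_pos (2 * r)))
  refine tendsto_nhds_unique (h1.congr hfin) h2

/-- The product of the Klein forms at the torsion points `j τ` for the lattice `(1, p τ)` is
`1 / f(q)`, up to a power of `q`. -/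
theorem prod_kleinForm_right_zero (r : ℕ) {τ : ℂ} (hτ : 0 < τ.im) :
    ∏ i ∈ Finset.range r, kleinForm ((i + 1 : ℕ) / (2 * r + 1 : ℕ)) 0 ((2 * r + 1 : ℕ) * τ) =
      (-1) ^ r * cexp (-(2 * π * I * τ * (((2 * r + 1 : ℕ) : ℂ) ^ 2 - 1) / 24)) *
      (eulerPhi (cexp (2 * π * I * τ)) /
        eulerPhi (cexp (2 * π * I * τ) ^ (2 * r + 1)) ^ (2 * r + 1)) := by
  have hq1 := norm_exp_two_pi_mul_I_lt_one hτ
  have hp0 : ((2 * r + 1 : ℕ) : ℂ) ≠ 0 := Nat.cast_ne_zero.mpr (Nat.succ_ne_zero _)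
  have hτ' : 0 < (((2 * r + 1 : ℕ) : ℂ) * τ).im := by
    rw [← ofReal_natCast, im_ofReal_mul]; positivity
  have hQ : ‖cexp (2 * π * I * τ) ^ (2 * r + 1)‖ < 1 :=
    norm_pow_lt_one hq1 (Nat.succ_ne_zero _)
  have hphi := eulerPhi_ne_zero hQ
  have key := prod_tprod_residues r hq1
  rw [← eq_div_iff hphi] at key
  have hQe : cexp (2 * π * I * ((2 * r + 1 : ℕ) * τ)) = cexp (2 * π * I * τ) ^ (2 * r + 1) := by
    rw [← exp_nat_mul]; ring_nf
  have hterm (i : ℕ) (hi : i ∈ Finset.range r) :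
      kleinForm ((i + 1 : ℕ) / (2 * r + 1 : ℕ)) 0 ((2 * r + 1 : ℕ) * τ) =
      -1 * cexp (π * I * τ * (((i + 1 : ℕ) : ℂ) ^ 2 / (2 * r + 1 : ℕ) - (i + 1 : ℕ))) *
      (∏' n : ℕ, ((1 - cexp (2 * π * I * τ) ^ ((2 * r + 1) * n + (i + 1))) *
        (1 - cexp (2 * π * I * τ) ^ ((2 * r + 1) * n + (2 * r + 1 - (i + 1)))))) *
      (eulerPhi (cexp (2 * π * I * τ) ^ (2 * r + 1)) ^ 2)⁻¹ := by
    have hi := Finset.mem_range.mp hi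
    have hz : ((i + 1 : ℕ) / (2 * r + 1 : ℕ) : ℂ) * ((2 * r + 1 : ℕ) * τ) + 0 =
        (i + 1 : ℕ) * τ := by field_simp; ring
    rw [kleinForm_eq_tprod _ _ hτ', hz, hQe]
    set q := cexp (2 * π * I * τ) with hq
    set Q := q ^ (2 * r + 1) with hQdef
    have hq0 : q ≠ 0 := exp_ne_zero _
    have e1 : cexp (2 * π * I * ((i + 1 : ℕ) * τ)) = q ^ (i + 1) := by
      rw [hq, ← exp_nat_mul]; ring_nf
    have hf := multipliable_one_sub_mul_pow_succ hQ (q ^ (i + 1))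
    have hg := multipliable_one_sub_mul_pow_succ hQ (q ^ (i + 1))⁻¹
    have f1 (n : ℕ) : 1 - (q ^ (i + 1))⁻¹ * Q ^ (n + 1) =
        1 - q ^ ((2 * r + 1) * n + (2 * r + 1 - (i + 1))) := by
      rw [pow_add q _ (2 * r + 1 - (i + 1)), pow_mul q (2 * r + 1) n, pow_sub₀ _ hq0 (by omega),
        pow_succ Q, ← hQdef]
      ring
    have f2 (n : ℕ) : 1 - q ^ (i + 1) * Q ^ n = 1 - q ^ ((2 * r + 1) * n + (i + 1)) := by
      rw [pow_add q _ (i + 1), pow_mul q (2 * r + 1) n]; ring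
    have hf2 := tprod_eq_zero_mul' (f := fun n : ℕ => 1 - q ^ (i + 1) * Q ^ n) hf
    have hf0 := multipliable_one_sub_mul_pow hQ (q ^ (i + 1))
    rw [exp_neg (2 * π * I * _), e1, hf.tprod_mul hg]
    simp only [f1, f2] at hg hf2 hf0 ⊢
    rw [hf0.tprod_mul hg, hf2, exp_neg]
    have e2 : cexp (π * I * ((i + 1 : ℕ) * τ)) ^ 2 = q ^ (i + 1) := by
      rw [← e1, ← exp_nat_mul]; push_cast; ring_nf
    have e3 : cexp (π * I * τ * (((i + 1 : ℕ) : ℂ) ^ 2 / (2 * r + 1 : ℕ) - (i + 1 : ℕ))) =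
        cexp (π * I * ((i + 1 : ℕ) / (2 * r + 1 : ℕ)) * ((i + 1 : ℕ) * τ)) *
          (cexp (π * I * ((i + 1 : ℕ) * τ)))⁻¹ := by
      rw [← exp_neg, ← exp_add]; ring_nf
    have e0 : cexp (π * I * ((i + 1 : ℕ) * τ)) ≠ 0 := exp_ne_zero _
    rw [e3, mul_zero, zero_add, ← e2]
    field_simp
    ring
  rw [Finset.prod_congr rfl hterm]
  simp only [Finset.prod_mul_distrib, Finset.prod_const, Finset.card_range] at key ⊢
  rw [key, ← exp_sum, ← Finset.mul_sum, Finset.sum_sub_distrib, ← Finset.sum_div,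
    sum_range_succ_cast, sum_range_succ_sq_cast]
  have he : π * I * τ * ((2 * r + 1) * ((2 * r + 1 : ℂ) ^ 2 - 1) / 24 / (2 * r + 1 : ℕ) -
      ((2 * r + 1 : ℂ) ^ 2 - 1) / 8) =
      -(2 * π * I * τ * (((2 * r + 1 : ℕ) : ℂ) ^ 2 - 1) / 24) := by
    push_cast at hp0 ⊢
    field_simp
    ring
  generalize eulerPhi (cexp (2 * π * I * τ) ^ (2 * r + 1)) = P at hphi
  rw [he, inv_pow, ← pow_mul, pow_succ P (2 * r)]
  field_simp

/-! ### Transformation of the products of Klein forms -/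

lemma kleinForm_add_int_right (a b τ : ℂ) (n : ℤ) :
    kleinForm a (b + n) τ = cexp (π * I * n * (1 + a)) * kleinForm a b τ := by
  have hper : Function.Periodic (fun b => cexp (-(π * I * b * (1 + a))) * kleinForm a b τ) 1 := by
    intro b
    have h : cexp (-(π * I * (b + 1) * (1 + a))) * -cexp (π * I * a) =
        cexp (-(π * I * b * (1 + a))) := by
      rw [← exp_antiperiodic, ← exp_add]; ring_nf
    simp only [kleinForm_add_one_right]
    rw [← h]
    ring
  have h := hper.int_mul n b
  simp only [mul_one] at h
  have h2 : cexp (-(π * I * b * (1 + a))) = cexp (-(π * I * (b + n) * (1 + a))) *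
      cexp (π * I * n * (1 + a)) := by
    rw [← exp_add]; ring_nf
  refine mul_left_cancel₀ (exp_ne_zero (-(π * I * (b + n) * (1 + a)))) (h.trans ?_)
  rw [h2, mul_assoc]

/-- Action of `k` on the product of the Klein forms at the torsion points `j / p` in the first
coordinate. The exponential is a sign, carried by the antiperiodicity of the Klein form. -/
lemma prod_kleinForm_mul_left {p r : ℕ} [Fact p.Prime] (hpr : p = 2 * r + 1) {k : ℤ}
    (hk : (k : ZMod p) ≠ 0) (τ : ℂ) :
    ∏ i ∈ Finset.range r, kleinForm ((i + 1 : ℕ) / p * k) 0 τ =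
      cexp (π * I * ((1 - k) * (((p : ℂ) ^ 2 - 1) / 8))) * (legendreSym p k : ℂ) *
        ∏ i ∈ Finset.range r, kleinForm ((i + 1 : ℕ) / p) 0 τ := by
  have hp0 : (p : ℂ) ≠ 0 := Nat.cast_ne_zero.mpr (Fact.out : p.Prime).ne_zero
  have hp2 : p ≠ 2 := by omega
  have hodd (n : ℤ) : cexp (π * I * (-n : ℤ)) * kleinForm ((-n : ℤ) / p) 0 τ =
      -(cexp (π * I * n) * kleinForm (n / p) 0 τ) := by
    have h1 : cexp (π * I * (-n : ℤ)) = cexp (π * I * n) := by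
      rw [← exp_periodic.int_mul n (π * I * (-n : ℤ))]; push_cast; ring_nf
    have h2 := kleinForm_neg (n / p) 0 τ
    rw [neg_zero] at h2
    rw [h1, Int.cast_neg, neg_div, h2]
    ring
  have hper : Function.Periodic (fun n : ℤ => cexp (π * I * n) * kleinForm (n / p) 0 τ) p := by
    intro n
    have h1 : cexp (π * I * (n + p : ℤ)) = -cexp (π * I * n) := by
      rw [← exp_antiperiodic, ← exp_periodic.nat_mul r (π * I * n + π * I), hpr]
      push_cast
      ring_nf
    have h2 : ((n + p : ℤ) : ℂ) / p = n / p + 1 := by push_cast; field_simp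
    have h3 := kleinForm_add_one_left (n / p) 0 τ
    rw [mul_zero, exp_zero] at h3
    simp only [h1, h2, h3]
    ring
  have h := prod_odd_periodic_mul p hp2 hk hodd hper
  have hIco (f : ℕ → ℂ) : ∏ j ∈ Finset.Ico 1 (p / 2).succ, f j =
      ∏ i ∈ Finset.range r, f (i + 1) := by
    rw [Finset.prod_Ico_eq_prod_range, show (p / 2).succ - 1 = r by omega]
    simp only [add_comm]
  rw [hIco (fun j => cexp (π * I * (k * j : ℤ)) * kleinForm ((k * j : ℤ) / p) 0 τ),
    hIco (fun j => cexp (π * I * (j : ℤ)) * kleinForm ((j : ℤ) / p) 0 τ),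
    Finset.prod_mul_distrib, Finset.prod_mul_distrib, ← exp_sum, ← exp_sum] at h
  have hs := sum_range_succ_cast r
  have hs' : ∑ i ∈ Finset.range r, ((i + 1 : ℕ) : ℂ) = ((p : ℂ) ^ 2 - 1) / 8 := by
    rw [hs, hpr]; push_cast; ring
  simp only [Int.cast_mul, Int.cast_natCast, ← Finset.mul_sum, hs'] at h
  have he : cexp (π * I * ((1 - k) * (((p : ℂ) ^ 2 - 1) / 8))) *
      cexp (π * I * (k * (((p : ℂ) ^ 2 - 1) / 8))) = cexp (π * I * (((p : ℂ) ^ 2 - 1) / 8)) := by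
    rw [← exp_add]; ring_nf
  have hne : cexp (π * I * (k * (((p : ℂ) ^ 2 - 1) / 8))) ≠ 0 := exp_ne_zero _
  have hcomm : ∏ i ∈ Finset.range r, kleinForm ((i + 1 : ℕ) / p * k) 0 τ =
      ∏ i ∈ Finset.range r, kleinForm (k * (i + 1 : ℕ) / p) 0 τ :=
    Finset.prod_congr rfl fun i _ => by congr 1; ring
  refine mul_left_cancel₀ hne ?_
  rw [hcomm, h, ← he]
  ring

/-- `24 ∣ p² - 1` for a prime `p ≥ 5`. -/
lemma exists_sq_eq_twentyfour_mul {p : ℕ} (hp : p.Prime) (h5 : 5 ≤ p) :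
    ∃ m : ℕ, p ^ 2 = 24 * m + 1 := by
  have h2 : p % 2 = 1 := hp.eq_two_or_odd.resolve_left (by omega)
  have h3 : ¬ 3 ∣ p := fun h => by
    have := (Nat.prime_dvd_prime_iff_eq Nat.prime_three hp).mp h
    omega
  have h24 : p ^ 2 % 24 = 1 := by
    have : p % 24 = 1 ∨ p % 24 = 5 ∨ p % 24 = 7 ∨ p % 24 = 11 ∨ p % 24 = 13 ∨ p % 24 = 17 ∨
        p % 24 = 19 ∨ p % 24 = 23 := by omega
    rw [Nat.pow_mod]
    rcases this with h | h | h | h | h | h | h | h <;> rw [h]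
  exact ⟨p ^ 2 / 24, by omega⟩

/-- The product of the Klein forms at `j / p`, evaluated at `γ τ` for
`γ = (B, c; k, -p h) ∈ SL₂(ℤ)`. All the roots of unity cancel because `gcd(h, k) = 1`. -/
theorem prod_kleinForm_smul {p r : ℕ} [Fact p.Prime] (hp5 : 5 ≤ p) (hpr : p = 2 * r + 1)
    {k h : ℤ} (hk : (k : ZMod p) ≠ 0) (hkh : IsCoprime h k) (γ : SL(2, ℤ)) (h10 : γ 1 0 = k)
    (h11 : γ 1 1 = -(p * h)) (τ : ℍ) :
    ∏ i ∈ Finset.range r, kleinForm 0 ((i + 1 : ℕ) / p) ↑(γ • τ) =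
      ((k * τ - p * h : ℂ)⁻¹) ^ r * (legendreSym p k : ℂ) *
        ∏ i ∈ Finset.range r, kleinForm ((i + 1 : ℕ) / p) 0 τ := by
  have hp0 : (p : ℂ) ≠ 0 := Nat.cast_ne_zero.mpr (Fact.out : p.Prime).ne_zero
  have hterm (i : ℕ) : kleinForm 0 ((i + 1 : ℕ) / p) ↑(γ • τ) =
      (k * τ - p * h : ℂ)⁻¹ * (cexp (π * I * (-h * (i + 1 : ℕ) - h * k * ((i + 1 : ℕ) ^ 2 / p))) *
        kleinForm ((i + 1 : ℕ) / p * k) 0 τ) := by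
    have h1 := kleinForm_add_int_right ((i + 1 : ℕ) / p * k) 0 τ (-(h * (i + 1 : ℕ)))
    rw [kleinForm_smul, h10, h11]
    have e1 : (0 : ℂ) * (γ 0 1 : ℤ) + (i + 1 : ℕ) / p * ((-(p * h) : ℤ) : ℂ) =
        0 + ((-(h * (i + 1 : ℕ)) : ℤ) : ℂ) := by
      push_cast
      field_simp
      ring
    rw [e1, zero_mul, zero_add, h1]
    congr 2
    · push_cast; ring
    · congr 1
      push_cast
      ring
  obtain ⟨m, hm⟩ := exists_sq_eq_twentyfour_mul (Fact.out : p.Prime) hp5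
  have hmC : (p : ℂ) ^ 2 = 24 * m + 1 := by exact_mod_cast hm
  have hs1 := sum_range_succ_cast r
  have hs2 := sum_range_succ_sq_cast r
  have hprC : (2 * r + 1 : ℂ) = p := by rw [hpr]; push_cast; ring
  rw [hprC] at hs1 hs2
  simp only [hterm, Finset.prod_mul_distrib, ← exp_sum, ← Finset.mul_sum, Finset.sum_sub_distrib,
    ← Finset.sum_div, hs1, hs2, Finset.prod_const, Finset.card_range]
  rw [prod_kleinForm_mul_left hpr hk]
  -- `h` and `k` are not both even
  obtain ⟨n, hn⟩ : Even ((h + 1) * (k + 1)) := by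
    by_contra hodd
    rw [Int.not_even_iff_odd, Int.odd_mul] at hodd
    have hh : (2 : ℤ) ∣ h := by have := hodd.1; rw [Int.odd_iff] at this; omega
    have hk' : (2 : ℤ) ∣ k := by have := hodd.2; rw [Int.odd_iff] at this; omega
    have := hkh.isUnit_of_dvd' hh hk'
    exact absurd this (by decide)
  have hnC : (h + 1 : ℂ) * (k + 1) = n + n := by exact_mod_cast hn
  have he : cexp (π * I * (-h * (((p : ℂ) ^ 2 - 1) / 8) -
      h * k * (p * ((p : ℂ) ^ 2 - 1) / 24 / p))) *
      cexp (π * I * ((1 - k) * (((p : ℂ) ^ 2 - 1) / 8))) = 1 := by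
    rw [← exp_add, exp_eq_one_iff]
    refine ⟨m * (2 - h - k - n), ?_⟩
    have e2 : (p * ((p : ℂ) ^ 2 - 1) / 24 / p) = m := by rw [hmC]; field_simp; ring
    rw [e2, hmC]
    push_cast
    linear_combination (-π * I * m) * hnC
  rw [mul_assoc (_ ^ r)]
  congr 1
  linear_combination ((legendreSym p k : ℂ) *
    ∏ i ∈ Finset.range r, kleinForm ((i + 1 : ℕ) / p) 0 τ) * he

/-! ### The transformation formula -/

lemma hasProd_one_sub_pow {q : ℂ} (hq : ‖q‖ < 1) :
    HasProd (fun n : ℕ => 1 - q ^ (n + 1)) (eulerPhi q) :=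
  (ModularForm.multipliable_one_sub_pow hq).hasProd

lemma hasProd_coreFactor {p : ℕ} (hp : p ≠ 0) {x : ℂ} (hx : ‖x‖ < 1) :
    HasProd (coreFactor p x) (eulerPhi (x ^ p) ^ p / eulerPhi x) := by
  have h := ((hasProd_one_sub_pow (norm_pow_lt_one hx hp)).pow p).mul
    ((hasProd_one_sub_pow hx).inv₀ (eulerPhi_ne_zero hx))
  rw [← div_eq_mul_inv] at h
  convert h using 1
  ext n
  rw [coreFactor, div_eq_mul_inv, pow_mul]

lemma hasProd_dualFactor {p : ℕ} (hp : p ≠ 0) {x : ℂ} (hx : ‖x‖ < 1) :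
    HasProd (dualFactor p x) (eulerPhi x ^ p / eulerPhi (x ^ p)) := by
  have hxp := norm_pow_lt_one hx hp
  have h := ((hasProd_one_sub_pow hx).pow p).mul
    ((hasProd_one_sub_pow hxp).inv₀ (eulerPhi_ne_zero hxp))
  rw [← div_eq_mul_inv] at h
  convert h using 1
  ext n
  rw [dualFactor, div_eq_mul_inv, pow_mul]

lemma dualProduct_eq_eta {p : ℕ} (hp : p ≠ 0) {τ : ℂ} (hτ : 0 < τ.im) :
    dualProduct p (cexp (2 * π * I * τ)) = ModularForm.eta τ ^ p / ModularForm.eta (p * τ) := by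
  have he : cexp (2 * π * I * τ / 24) ^ p = cexp (2 * π * I * (p * τ) / 24) := by
    rw [← exp_nat_mul]; ring_nf
  have he2 : cexp (2 * π * I * (p * τ)) = cexp (2 * π * I * τ) ^ p := by
    rw [← exp_nat_mul]; ring_nf
  have hne : cexp (2 * π * I * (p * τ) / 24) ≠ 0 := exp_ne_zero _
  rw [dualProduct, (hasProd_dualFactor hp (norm_exp_two_pi_mul_I_lt_one hτ)).tprod_eq, eta_eq,
    eta_eq, mul_pow, he, he2, mul_div_mul_left _ _ hne]

/-- The transformation formula for `f` near the root of unity `e^{2πi h / k}`, by comparing the two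
products of Klein forms at `pτ₀` and `γ(pτ₀)`, where `τ₀ = h / k + i t / 2π`. -/
theorem coreProduct_transformation {p : ℕ} [Fact p.Prime] (hp : 5 ≤ p) {h : ℤ} {k : ℕ} {B : ℤ}
    {t : ℂ} (hk : 0 < k) (hhk : IsCoprime h (k : ℤ)) (hpk : Nat.Coprime p k)
    (hB : B * p * h ≡ -1 [ZMOD (k : ℤ)]) (ht : 0 < t.re) :
    coreProduct p (cexp (2 * π * I * h / k - t)) =
      (2 * π / k : ℂ) ^ ((p - 1) / 2 : ℕ) * ((legendreSym p (k : ℤ) : ℤ) : ℂ) *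
        (((p : ℝ) ^ (-(p : ℝ) / 2) : ℝ) : ℂ) * (t ^ ((p - 1) / 2 : ℕ))⁻¹ *
        cexp (((p : ℂ) ^ 2 - 1) / 24 * t - π * I * ((p : ℂ) ^ 2 - 1) * h / (12 * k)) *
        dualProduct p (cexp (2 * π * I * B / k - 4 * (π : ℂ) ^ 2 / ((k : ℂ) ^ 2 * p * t))) := by
  have hpp : p.Prime := Fact.out
  obtain ⟨r, hpr⟩ : ∃ r, p = 2 * r + 1 := ⟨p / 2, by have := hpp.eq_two_or_odd; omega⟩
  have hr : (p - 1) / 2 = r := by omega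
  have hp0 : (p : ℂ) ≠ 0 := Nat.cast_ne_zero.mpr hpp.ne_zero
  have hk0 : (k : ℂ) ≠ 0 := Nat.cast_ne_zero.mpr hk.ne'
  have ht0 : t ≠ 0 := by rintro rfl; simp at ht
  have hπ : (π : ℂ) ≠ 0 := ofReal_ne_zero.mpr Real.pi_ne_zero
  -- the points `τ₀`, with `x = e^{2πiτ₀}`, and `p τ₀`
  set τ₀ : ℂ := h / k + I * t / (2 * π) with hτ₀
  have him : 0 < τ₀.im := by
    have e1 : (I * t / (2 * π)).im = t.re / (2 * π) := by
      rw [show (2 * π : ℂ) = ((2 * π : ℝ) : ℂ) by push_cast; rfl, div_ofReal_im]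
      simp
    have e2 : ((h : ℂ) / k).im = 0 := by
      rw [← ofReal_intCast, ← ofReal_natCast, ← ofReal_div, ofReal_im]
    rw [hτ₀, add_im, e1, e2]
    positivity
  have him' : 0 < ((p : ℂ) * τ₀).im := by
    rw [← ofReal_natCast, im_ofReal_mul]
    exact mul_pos (Nat.cast_pos.mpr hpp.pos) him
  let τ : ℍ := ⟨p * τ₀, him'⟩
  have hτ : (τ : ℂ) = p * τ₀ := rfl
  -- the matrix `(B, c; k, -p h)`
  obtain ⟨c, hc⟩ : (k : ℤ) ∣ -1 - B * p * h := hB.dvd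
  let γ : SL(2, ℤ) := ⟨!![B, c; k, -(p * h)], by
    rw [Matrix.det_fin_two_of]; linear_combination hc⟩
  have hcC : (-1 - B * p * h : ℂ) = k * c := by exact_mod_cast hc
  have hden : (k * τ - p * h : ℂ) = p * I * k * t / (2 * π) := by
    rw [hτ, hτ₀]; field_simp; ring
  have hγ : (↑(γ • τ) : ℂ) = B / k + 2 * π * I / (k ^ 2 * p * t) := by
    have e1 : ((k : ℤ) : ℂ) * τ + ((-(p * h) : ℤ) : ℂ) = p * I * k * t / (2 * π) := by
      rw [← hden]; push_cast; ring
    have e2 : (γ 1 0 : ℤ) = k := rfl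
    have e3 : (γ 1 1 : ℤ) = -(p * h) := rfl
    have e4 : (γ 0 0 : ℤ) = B := rfl
    have e5 : (γ 0 1 : ℤ) = c := rfl
    rw [coe_smul_eq_div, e2, e3, e4, e5, e1, hτ, hτ₀]
    field_simp
    linear_combination (-2 * π) * hcC - 2 * π * I_sq
  have hx : cexp (2 * π * I * h / k - t) = cexp (2 * π * I * τ₀) := by
    congr 1
    rw [hτ₀]
    field_simp
    linear_combination (-t * k) * I_sq
  have hy : cexp (2 * π * I * B / k - 4 * (π : ℂ) ^ 2 / ((k : ℂ) ^ 2 * p * t)) =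
      cexp (2 * π * I * ↑(γ • τ)) := by
    congr 1
    rw [hγ]
    field_simp
    linear_combination (-4 * π) * I_sq
  have hkp : ((k : ℤ) : ZMod p) ≠ 0 := by
    rw [Int.cast_natCast, Ne, ZMod.natCast_eq_zero_iff]
    exact (Nat.Prime.coprime_iff_not_dvd hpp).mp hpk
  have key := prod_kleinForm_smul hp hpr hkp hhk γ rfl rfl τ
  have hA := prod_kleinForm_zero_left r (γ • τ).im_pos
  have hB' := prod_kleinForm_right_zero r him
  rw [← hpr] at hA hB'
  have hq1 := norm_exp_two_pi_mul_I_lt_one him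
  have hQ1 := norm_exp_two_pi_mul_I_lt_one (γ • τ).im_pos
  rw [hτ, hA, hB', Int.cast_natCast, ← hτ, hden] at key
  rw [hx, hy, coreProduct, dualProduct, (hasProd_coreFactor hpp.ne_zero hq1).tprod_eq,
    (hasProd_dualFactor hpp.ne_zero hQ1).tprod_eq, hr]
  have hP1 := eulerPhi_ne_zero hq1
  have hP2 := eulerPhi_ne_zero (norm_pow_lt_one hq1 hpp.ne_zero)
  have hP3 := eulerPhi_ne_zero hQ1
  have hP4 := eulerPhi_ne_zero (norm_pow_lt_one hQ1 hpp.ne_zero)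
  have hexp : cexp (((p : ℂ) ^ 2 - 1) / 24 * t - π * I * ((p : ℂ) ^ 2 - 1) * h / (12 * k)) =
      cexp (-(2 * π * I * τ₀ * ((p : ℂ) ^ 2 - 1) / 24)) := by
    congr 1
    rw [hτ₀]
    field_simp
    linear_combination (12 * t * k * (p ^ 2 - 1)) * I_sq
  have hpow : (((p : ℝ) ^ (-(p : ℝ) / 2) : ℝ) : ℂ) * ((√(p : ℝ) : ℝ) * (p : ℂ) ^ r) = 1 := by
    have hpR : (0 : ℝ) < p := Nat.cast_pos.mpr hpp.pos
    have hprR : (p : ℝ) = 2 * r + 1 := by rw [hpr]; push_cast; ring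
    have : (p : ℝ) ^ (-(p : ℝ) / 2) * (√(p : ℝ) * (p : ℝ) ^ r) = 1 := by
      rw [Real.sqrt_eq_rpow, ← Real.rpow_natCast (p : ℝ) r, ← Real.rpow_add hpR,
        ← Real.rpow_add hpR, show -(p : ℝ) / 2 + (1 / 2 + r) = 0 by linarith, Real.rpow_zero]
    exact_mod_cast this
  have hD : (p * I * k * t / (2 * π) : ℂ)⁻¹ ^ r * (-1) ^ r =
      I ^ r * (2 * π / k : ℂ) ^ r * (t ^ r)⁻¹ * ((p : ℂ) ^ r)⁻¹ := by
    rw [← inv_pow t, ← inv_pow (p : ℂ), ← mul_pow, ← mul_pow, ← mul_pow, ← mul_pow]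
    congr 1
    field_simp
    linear_combination -I_sq
  have hs : ((√(p : ℝ) : ℝ) : ℂ) ≠ 0 := fun h0 => by simp [h0] at hpow
  have hpr0 : (p : ℂ) ^ r ≠ 0 := pow_ne_zero r hp0
  have hR := eq_inv_of_mul_eq_one_left hpow
  have hIr : (I : ℂ) ^ r ≠ 0 := pow_ne_zero r I_ne_zero
  rw [hexp, hR]
  generalize cexp (-(2 * π * I * τ₀ * ((p : ℂ) ^ 2 - 1) / 24)) = E at *
  generalize eulerPhi (cexp (2 * π * I * τ₀)) = P1 at *
  generalize eulerPhi (cexp (2 * π * I * τ₀) ^ p) = P2 at *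
  generalize eulerPhi (cexp (2 * π * I * ↑(γ • τ))) = P3 at *
  generalize eulerPhi (cexp (2 * π * I * ↑(γ • τ)) ^ p) = P4 at *
  have key2 : ((√(p : ℝ) : ℝ) : ℂ) * (P4 / P3 ^ p) = (2 * π / k : ℂ) ^ r * (t ^ r)⁻¹ *
      ((p : ℂ) ^ r)⁻¹ * (legendreSym p k : ℂ) * E * (P1 / P2 ^ p) := by
    refine mul_left_cancel₀ hIr ?_
    linear_combination key + (legendreSym p k : ℂ) * E * (P1 / P2 ^ p) * hD
  have e3 : P2 ^ p / P1 = ((√(p : ℝ) : ℝ) : ℂ)⁻¹ * (((√(p : ℝ) : ℝ) : ℂ) * (P4 / P3 ^ p)) *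
      (P3 ^ p / P4) * (P2 ^ p / P1) := by
    field_simp
  rw [e3, key2]
  field_simp

theorem theorem3p3 (p : ℕ) [Fact p.Prime] (hp : 5 ≤ p) :
    (∀ x : ℂ, ‖x‖ < 1 → Multipliable (coreFactor p x) ∧ Multipliable (dualFactor p x)) ∧
    (∀ τ : ℂ, 0 < τ.im →
      dualProduct p (Complex.exp (2 * Real.pi * Complex.I * τ)) =
        ModularForm.eta τ ^ p / ModularForm.eta (p * τ)) ∧
    (∀ (h : ℤ) (k : ℕ) (B : ℤ) (t : ℂ),
      0 < k → IsCoprime h (k : ℤ) → Nat.Coprime p k → B * p * h ≡ -1 [ZMOD (k : ℤ)] → 0 < t.re →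
      coreProduct p (Complex.exp (2 * Real.pi * Complex.I * h / k - t)) =
        (2 * Real.pi / k : ℂ) ^ ((p - 1) / 2 : ℕ) * ((legendreSym p (k : ℤ) : ℤ) : ℂ) *
          (((p : ℝ) ^ (-(p : ℝ) / 2) : ℝ) : ℂ) * (t ^ ((p - 1) / 2 : ℕ))⁻¹ *
          Complex.exp (((p : ℂ) ^ 2 - 1) / 24 * t
            - Real.pi * Complex.I * ((p : ℂ) ^ 2 - 1) * h / (12 * k)) *
          dualProduct p (Complex.exp (2 * Real.pi * Complex.I * B / k
            - 4 * (Real.pi : ℂ) ^ 2 / ((k : ℂ) ^ 2 * p * t)))) :=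
  ⟨fun _ hx => ⟨(hasProd_coreFactor (by omega) hx).multipliable,
      (hasProd_dualFactor (by omega) hx).multipliable⟩,
    fun _ hτ => dualProduct_eq_eta (by omega) hτ,
    fun _ _ _ _ hk hhk hpk hB ht => coreProduct_transformation hp hk hhk hpk hB ht⟩
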